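/- Consider $n$ processes, each a deterministic state machine, communicating over an authenticated, reliable point-to-point network in the partially synchronous model: in every execution there is a time GST, unknown to the processes, such that a message sent at time $s$ between correct processes is received by time $\max(s,\mathrm{GST})+\delta$, every correct process starts by GST, and local clocks may drift arbitrarily before GST but not afterwards. At most $t$ processes, $0<t<n$, are faulty (Byzantine); processes may use digital signatures, and faulty processes cannot forge signatures of correct ones. Let $\mathcal V_I\neq\emptyset$ and $\mathcal V_O$ be the (possibly infinite) sets of proposals and of decisions. An input configuration assigns proposals from $\mathcal V_I$ to the members of some set of at least $n-t$ processes (the correct ones). A validity property $\mathit{val}$ maps every input configuration $c$ to a non-empty set $\mathit{val}(c)\subseteq\mathcal V_O$ of admissible decisions; it is non-trivial if no single value belongs to $\mathit{val}(c)$ for all input configurations $c$. An algorithm solves Byzantine consensus with $\mathit{val}$ if, in every execution with at most $t$ faulty processes, every correct process eventually decides, no two correct processes decide different values, and correct processes decide only values in $\mathit{val}(c)$, where $c$ is the assignment of proposals to the correct processes of the execution. The message complexity of an execution is the number of messages sent by correct processes during $[\mathrm{GST},\infty)$ (not counting messages that a process sends to itself), and the message complexity of an algorithm is the supremum over its executions.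 **Theorem.** If an algorithm solves Byzantine consensus with a non-trivial validity property, then its message complexity is greater than $\lceil t/2\rceil^2$, hence $\Omega(t^2)$. More precisely, the algorithm has an execution with $\mathrm{GST}=0$ (synchronous from the very beginning) in which correct processes send more than $\lceil t/2\rceil^2$ messages. -/

import Mathlib

namespace Consensus

universe u v w a b

/-! ### Input configurations and validity properties -/

/-- An assignment of proposals to the correct processes: `c.prop i = some v` if process `i` is
included with proposal `v`, and `none` if `i` is not included.  Between `n - t` and `n` processes
are included. -/
structure InputConfig (n t : ℕ) (VI : Type a) where
  prop : Fin n → Option VI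
  card_le : n ≤ (Finset.univ.filter fun i => (prop i).isSome).card + t

/-- A validity property: every input configuration gets a non-empty set of admissible decisions. -/
structure ValidityProperty (n t : ℕ) (VI : Type a) (VO : Type b) where
  admissible : InputConfig n t VI → Set VO
  nonempty : ∀ c, (admissible c).Nonempty

/-- Some value is admissible for all input configurations. -/
def ValidityProperty.IsTrivial {n t : ℕ} {VI : Type a} {VO : Type b}
    (val : ValidityProperty n t VI VO) : Prop :=
  ∃ v, ∀ c, v ∈ val.admissible c

/-! ### Processes: deterministic event-driven state machines -/

/-- What a process perceives at one instant: whether its local clock ticks, and which messages it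
receives from each process (the network is authenticated: senders are known). -/
structure Input (n : ℕ) (Msg : Type v) where
  tick : Bool
  inbox : Fin n → Multiset Msg

/-- Nothing happens: no clock tick and no message. -/
def Input.IsIdle {n : ℕ} {Msg : Type v} (x : Input n Msg) : Prop :=
  x.tick = false ∧ ∀ j, x.inbox j = 0

/-- The result of a computational step: new state, messages to each process, and possibly a
decision. -/
structure Effect (n : ℕ) (State : Type u) (Msg : Type v) (VO : Type b) where
  state : State
  outbox : Fin n → Multiset Msg
  decision : Option VO

/-- The code of all `n` processes.  `signed m` is the set of digital signatures contained in the
message `m`: `(k, y) ∈ signed m` means that `m` contains `y` signed by process `k`.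
(Protocols without signatures have `signed m = ∅`.) -/
structure Machine (n : ℕ) (VI : Type a) (VO : Type b) where
  State : Type u
  Msg : Type v
  Sig : Type w
  signed : Msg → Set (Fin n × Sig)
  init : Fin n → VI → State
  step : Fin n → State → Input n Msg → Effect n State Msg VO

namespace Machine

variable {n : ℕ} {VI : Type a} {VO : Type b} (M : Machine.{u, v, w} n VI VO)

open Classical in
/-- State of process `i` with proposal `p` before instant `r`, given what it perceives at each
instant.  The process takes a step exactly at the instants at which its clock ticks or at which it
receives a message. -/
noncomputable def state (i : Fin n) (p : VI) (x : ℕ → Input n M.Msg) : ℕ → M.State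
  | 0 => M.init i p
  | r + 1 => if (x r).IsIdle then state i p x r else (M.step i (state i p x r) (x r)).state

open Classical in
/-- Messages sent by process `i` at instant `r`. -/
noncomputable def outbox (i : Fin n) (p : VI) (x : ℕ → Input n M.Msg) (r : ℕ) :
    Fin n → Multiset M.Msg :=
  if (x r).IsIdle then fun _ => 0 else (M.step i (M.state i p x r) (x r)).outbox

open Classical in
/-- The decision (if any) that process `i` issues at instant `r`. -/
noncomputable def decision (i : Fin n) (p : VI) (x : ℕ → Input n M.Msg) (r : ℕ) : Option VO :=
  if (x r).IsIdle then none else (M.step i (M.state i p x r) (x r)).decision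

end Machine

/-- An algorithm: its processes do not forge signatures, that is, every signature in a message
sent by process `i` is by `i` itself or is contained in a message that `i` has received. -/
structure Algorithm (n : ℕ) (VI : Type a) (VO : Type b) extends Machine.{u, v, w} n VI VO where
  own_or_received : ∀ (i : Fin n) (p : VI) (x : ℕ → Input n Msg) (r : ℕ) (j : Fin n),
    ∀ m ∈ toMachine.outbox i p x r j, ∀ (k : Fin n) (y : Sig), (k, y) ∈ signed m →
      k = i ∨ ∃ s ≤ r, ∃ j', ∃ m' ∈ (x s).inbox j', (k, y) ∈ signed m'

/-! ### Executions in the partially synchronous model -/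

/-- The (infinite) executions of `A` with at most `t` Byzantine processes, message delay bound `δ`
after GST, and local clocks which, when they do not drift, tick once every `ρ` units of time.
Whatever happens in the execution happens at the instants `time 0 < time 1 < ⋯`, of which only
finitely many lie in any bounded interval.  The inputs of faulty processes are irrelevant; only
the messages they send matter. -/
structure Execution {n : ℕ} {VI : Type a} {VO : Type b} (A : Algorithm.{u, v, w} n VI VO)
    (t : ℕ) (δ ρ : ℝ) where
  /-- the global stabilization time -/
  GST : ℝ
  GST_nonneg : 0 ≤ GST
  time : ℕ → ℝ
  time_nonneg : 0 ≤ time 0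
  time_strictMono : StrictMono time
  time_tendsto : Filter.Tendsto time Filter.atTop Filter.atTop
  correct : Finset (Fin n)
  card_correct : n ≤ correct.card + t
  proposal : Fin n → VI
  /-- what process `i` perceives at each instant -/
  input : Fin n → ℕ → Input n A.Msg
  /-- `sent i j r`: the messages which `i` sends to `j` at instant `r` -/
  sent : Fin n → Fin n → ℕ → Multiset A.Msg
  /-- correct processes follow the algorithm -/
  sent_eq : ∀ i ∈ correct, ∀ j r, sent i j r = A.outbox i (proposal i) (input i) r j
  /-- the instant of the first step of each process -/
  start : Fin n → ℕ
  start_le : ∀ i ∈ correct, time (start i) ≤ GST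
  start_tick : ∀ i ∈ correct, (input i (start i)).tick = true
  before_start : ∀ i ∈ correct, ∀ r < start i, (input i r).IsIdle
  /-- after GST, local clocks do not run fast -/
  tick_not_fast : ∀ i ∈ correct, ∀ r r', r < r' → GST ≤ time r →
    (input i r).tick = true → (input i r').tick = true → time r + ρ ≤ time r'
  /-- after GST, local clocks do not run slow -/
  tick_not_slow : ∀ i ∈ correct, ∀ r, (input i r).tick = true →
    ∃ r' > r, (input i r').tick = true ∧ time r' ≤ max (time r) GST + ρ
  /-- a correct process receives only messages that were sent before, each at most once: the
  messages received from `i` up to any instant are among those that `i` sent earlier -/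
  received_le_sent : ∀ i, ∀ j ∈ correct, ∀ r,
    ∑ s ∈ Finset.range (r + 1), (input j s).inbox i ≤ ∑ s ∈ Finset.range r, sent i j s
  /-- reliability, with delays at most `δ` after GST -/
  delivered : ∀ i ∈ correct, ∀ j ∈ correct, ∀ s, ∃ r, time r ≤ max (time s) GST + δ ∧
    ∑ q ∈ Finset.range (s + 1), sent i j q ≤ ∑ q ∈ Finset.range (r + 1), (input j q).inbox i
  /-- faulty processes cannot forge signatures of correct ones: such a signature is used only
  after a correct process sent a message containing it to a faulty process -/
  unforgeable : ∀ i ∉ correct, ∀ j r, ∀ m ∈ sent i j r, ∀ k ∈ correct, ∀ y,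
    (k, y) ∈ A.signed m →
      ∃ s < r, ∃ i' ∈ correct, ∃ j' ∉ correct, ∃ m' ∈ sent i' j' s, (k, y) ∈ A.signed m'

namespace Execution

variable {n : ℕ} {VI : Type a} {VO : Type b} {A : Algorithm.{u, v, w} n VI VO} {t : ℕ} {δ ρ : ℝ}

/-- The input configuration to which the execution corresponds. -/
def inputConf (E : Execution A t δ ρ) : InputConfig n t VI where
  prop i := if i ∈ E.correct then some (E.proposal i) else none
  card_le := by
    have h : (Finset.univ.filter fun i =>
        (if i ∈ E.correct then some (E.proposal i) else none).isSome) = E.correct := by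
      ext i
      by_cases hi : i ∈ E.correct <;> simp [hi]
    rw [h]
    exact E.card_correct

/-- The (correct) process `i` decides `d` at some point of the execution. -/
def Decides (E : Execution A t δ ρ) (i : Fin n) (d : VO) : Prop :=
  ∃ r, A.decision i (E.proposal i) (E.input i) r = some d

open Classical in
/-- The number (possibly infinite) of messages sent by correct processes during `[GST, ∞)`.
Messages that a process addresses to itself are not counted. -/
noncomputable def messageComplexity (E : Execution A t δ ρ) : ℕ∞ :=
  ⨆ R : ℕ, ((∑ r ∈ (Finset.range R).filter (fun r => E.GST ≤ E.time r),
    ∑ i ∈ E.correct, ∑ j ∈ Finset.univ.erase i, (E.sent i j r).card : ℕ) : ℕ∞)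

end Execution

namespace Algorithm

variable {n : ℕ} {VI : Type a} {VO : Type b}

/-- `A` solves consensus with the validity property `val` in every execution with at most `t`
faulty processes. -/
structure Solves {t : ℕ} (A : Algorithm.{u, v, w} n VI VO) (δ ρ : ℝ)
    (val : ValidityProperty n t VI VO) : Prop where
  termination : ∀ E : Execution A t δ ρ, ∀ i ∈ E.correct, ∃ d, E.Decides i d
  agreement : ∀ E : Execution A t δ ρ, ∀ i ∈ E.correct, ∀ j ∈ E.correct, ∀ d d',
    E.Decides i d → E.Decides j d' → d = d'
  validity : ∀ E : Execution A t δ ρ, ∀ i ∈ E.correct, ∀ d,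
    E.Decides i d → d ∈ val.admissible E.inputConf

/-- The largest message complexity of an execution of `A`. -/
noncomputable def messageComplexity (A : Algorithm.{u, v, w} n VI VO) (t : ℕ) (δ ρ : ℝ) : ℕ∞ :=
  ⨆ E : Execution A t δ ρ, E.messageComplexity

end Algorithm

end Consensus

namespace Consensus

universe u v w a b

/-! ### Dependence of a process on its past inputs -/

section Congruence

variable {n : ℕ} {VI : Type a} {VO : Type b} (M : Machine.{u, v, w} n VI VO)

/-! Let `b = ⌈t/2⌉`. Run the algorithm with a set `B` of `b` processes deaf to everybody else. With
`B` declared faulty, this is an execution with GST 0. If every member of `B` is addressed by more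
than `b` processes outside `B`, at least `b * (b + 1) > b ^ 2` messages are sent. Otherwise some `Q`
in `B` is addressed by at most `b` outsiders. Declare these and `B \ {Q}` faulty, at most `2 * b - 1
≤ t` processes, and let them omit their messages to `Q`: in the same run `Q` is now correct, so it
decides some `v` without hearing from anyone.

Such a `v` is admissible for every configuration `c` (`Solves.mem_admissible_of_isolated`). With
proposals from `c` and `Q` silent, the others decide some `d`. Delaying all traffic between `Q` and
the others until both decisions have been made forces `d = v` by agreement. Hence processes
proposing according to `c` decide `v`, contradicting non-triviality.

All executions come from one construction, `Algorithm.execution`: everybody follows the algorithm,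
links open at prescribed instants, and the set `C` of correct processes is a label that does not
affect the run. `Machine.run_congr` provides indistinguishability. -/

theorem Machine.state_congr (i : Fin n) (p : VI) {x y : ℕ → Input n M.Msg} (r : ℕ)
    (h : ∀ q < r, x q = y q) : M.state i p x r = M.state i p y r := by
  induction r with
  | zero => rfl
  | succ r ih =>
    have h1 := ih fun q hq => h q (by omega)
    have h2 := h r (by omega)
    rw [Machine.state, Machine.state, h1, h2]

theorem Machine.outbox_congr (i : Fin n) (p : VI) {x y : ℕ → Input n M.Msg} (r : ℕ)
    (h : ∀ q ≤ r, x q = y q) : M.outbox i p x r = M.outbox i p y r := by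
  rw [Machine.outbox, Machine.outbox, M.state_congr i p r fun q hq => h q hq.le, h r le_rfl]

theorem Machine.decision_congr (i : Fin n) (p : VI) {x y : ℕ → Input n M.Msg} (r : ℕ)
    (h : ∀ q ≤ r, x q = y q) : M.decision i p x r = M.decision i p y r := by
  rw [Machine.decision, Machine.decision, M.state_congr i p r fun q hq => h q hq.le, h r le_rfl]

end Congruence

/-! ### Messages that pass a gate -/

/-- The messages arriving at instant `r` over a link which is closed before instant `G`, when
`s q` is sent at instant `q`: once the link is open, messages take one instant. -/
noncomputable def arrivals {Msg : Type v} (G : WithTop ℕ) (s : ℕ → Multiset Msg) (r : ℕ) :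
    Multiset Msg :=
  if G = r then ∑ q ∈ Finset.range r, s q else if G < r then s (r - 1) else 0

theorem arrivals_congr {Msg : Type v} (G : WithTop ℕ) {s s' : ℕ → Multiset Msg} (r : ℕ)
    (h : ∀ q < r, s q = s' q) : arrivals G s r = arrivals G s' r := by
  unfold arrivals
  split_ifs with h1 h2
  · exact Finset.sum_congr rfl fun q hq => h q (Finset.mem_range.1 hq)
  · have hr : r ≠ 0 := by
      rintro rfl
      simp at h2
    exact h _ (by omega)
  · rfl

theorem arrivals_of_lt {Msg : Type v} {G : WithTop ℕ} (s : ℕ → Multiset Msg) {r : ℕ}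
    (h : (r : WithTop ℕ) < G) : arrivals G s r = 0 := by
  simp [arrivals, h.ne', not_lt_of_gt h]

/-- The sum telescopes: the backlog arrives in bulk at the opening, then one instant's messages at a
time. Both `received_le_sent` and `delivered` follow from this formula. -/
theorem sum_arrivals {Msg : Type v} (G : WithTop ℕ) (s : ℕ → Multiset Msg) (r : ℕ) :
    ∑ q ∈ Finset.range (r + 1), arrivals G s q =
      if G ≤ r then ∑ q ∈ Finset.range r, s q else 0 := by
  induction r with
  | zero =>
    by_cases h : G = 0 <;> simp [arrivals, h]
  | succ r ih =>
    rw [Finset.sum_range_succ, ih]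
    cases G with
    | top =>
      have h : (⊤ : WithTop ℕ) ≠ ((r + 1 : ℕ) : WithTop ℕ) := WithTop.top_ne_coe
      simp [arrivals, -Nat.cast_add, h]
    | coe G =>
      simp only [arrivals, WithTop.coe_eq_coe, Nat.cast_withTop, WithTop.coe_le_coe,
        WithTop.coe_lt_coe]
      rcases lt_trichotomy G (r + 1) with h | h | h
      · simp [h, h.ne, h.le, Nat.lt_succ_iff.1 h, Finset.sum_range_succ]
      · simp [h]
      · simp [h.ne', not_lt_of_gt h, not_le_of_gt h, show ¬ G ≤ r by omega]

theorem exists_of_mem_arrivals {Msg : Type v} {G : WithTop ℕ} {s : ℕ → Multiset Msg} {r : ℕ}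
    {m : Msg} (h : m ∈ arrivals G s r) : G ≠ ⊤ ∧ ∃ q < r, m ∈ s q := by
  unfold arrivals at h
  split_ifs at h with h1 h2
  · refine ⟨by simp [h1], ?_⟩
    obtain ⟨q, hq, hm⟩ := Multiset.mem_sum.1 h
    exact ⟨q, Finset.mem_range.1 hq, hm⟩
  · refine ⟨h2.ne_top, r - 1, ?_, h⟩
    have hr : r ≠ 0 := by
      rintro rfl
      simp at h2
    omega
  · simp at h

/-! ### Runs in which all processes follow the algorithm -/

namespace Machine

variable {n : ℕ} {VI : Type a} {VO : Type b} (M : Machine.{u, v, w} n VI VO)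

/-- What process `j` perceives at instant `r` if clocks tick every `K` instants, the link from
`i` to `j` is closed before instant `G i j`, and processes perceived `x` before. -/
noncomputable def perceive (K : ℕ) (g : Fin n → VI) (G : Fin n → Fin n → WithTop ℕ)
    (x : Fin n → ℕ → Input n M.Msg) (j : Fin n) (r : ℕ) : Input n M.Msg where
  tick := decide (K ∣ r)
  inbox i := arrivals (G i j) (fun q => M.outbox i (g i) (x i) q j) r

theorem perceive_congr (K : ℕ) (g : Fin n → VI) (G : Fin n → Fin n → WithTop ℕ)
    {x y : Fin n → ℕ → Input n M.Msg} (j : Fin n) (r : ℕ) (h : ∀ i, ∀ q < r, x i q = y i q) :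
    M.perceive K g G x j r = M.perceive K g G y j r := by
  simp only [perceive, Input.mk.injEq, true_and]
  funext i
  refine arrivals_congr _ _ fun q hq => ?_
  rw [M.outbox_congr i (g i) q fun q' hq' => h i q' (by omega)]

/-- The first `r` instants of the run. -/
noncomputable def history (K : ℕ) (g : Fin n → VI) (G : Fin n → Fin n → WithTop ℕ) :
    ℕ → Fin n → ℕ → Input n M.Msg
  | 0 => fun _ _ => ⟨false, fun _ => 0⟩
  | r + 1 => fun j q =>
      if q = r then M.perceive K g G (history K g G r) j r else history K g G r j q

/-- What processes perceive when all of them follow the algorithm, with proposals `g` and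
links that open at the instants `G`. -/
noncomputable def run (K : ℕ) (g : Fin n → VI) (G : Fin n → Fin n → WithTop ℕ)
    (j : Fin n) (r : ℕ) : Input n M.Msg :=
  M.history K g G (r + 1) j r

theorem history_eq_run (K : ℕ) (g : Fin n → VI) (G : Fin n → Fin n → WithTop ℕ)
    (j : Fin n) {q r : ℕ} (h : q < r) : M.history K g G r j q = M.run K g G j q := by
  induction r with
  | zero => omega
  | succ r ih =>
    rcases Nat.lt_succ_iff_lt_or_eq.1 h with h | rfl
    · simp only [history, if_neg h.ne, ih h]
    · rfl

/-- The equation that characterises the run; it is well-founded because messages take at least one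
instant. -/
theorem run_eq (K : ℕ) (g : Fin n → VI) (G : Fin n → Fin n → WithTop ℕ) (j : Fin n) (r : ℕ) :
    M.run K g G j r = M.perceive K g G (M.run K g G) j r := by
  simp only [run, history, if_true]
  exact M.perceive_congr K g G j r fun i q hq => M.history_eq_run K g G i hq

/-- The messages that `i` sends to `j` at instant `r` of the run. -/
noncomputable def runSent (K : ℕ) (g : Fin n → VI) (G : Fin n → Fin n → WithTop ℕ)
    (i j : Fin n) (r : ℕ) : Multiset M.Msg :=
  M.outbox i (g i) (M.run K g G i) r j

theorem run_tick (K : ℕ) (g : Fin n → VI) (G : Fin n → Fin n → WithTop ℕ) (j : Fin n) (r : ℕ) :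
    (M.run K g G j r).tick = true ↔ K ∣ r := by
  rw [run_eq]
  simp [perceive]

theorem run_inbox (K : ℕ) (g : Fin n → VI) (G : Fin n → Fin n → WithTop ℕ)
    (i j : Fin n) (r : ℕ) :
    (M.run K g G j r).inbox i = arrivals (G i j) (M.runSent K g G i j) r := by
  rw [run_eq]
  rfl

/-- A group of processes cannot distinguish, before instant `N`, two runs in which it is
isolated from the other processes until then. -/
theorem run_congr (K : ℕ) {g g' : Fin n → VI} {G G' : Fin n → Fin n → WithTop ℕ}
    (P : Set (Fin n)) (N : ℕ) (hg : ∀ i ∈ P, g i = g' i)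
    (hin : ∀ i ∈ P, ∀ j ∈ P, G i j = G' i j)
    (hout : ∀ i ∉ P, ∀ j ∈ P, (N : WithTop ℕ) ≤ G i j ∧ (N : WithTop ℕ) ≤ G' i j)
    (r : ℕ) (hr : r < N) : ∀ j ∈ P, M.run K g G j r = M.run K g' G' j r := by
  induction r using Nat.strong_induction_on with
  | _ r ih =>
    intro j hj
    rw [run_eq, run_eq M K g']
    simp only [perceive, Input.mk.injEq, true_and]
    funext i
    by_cases hi : i ∈ P
    · rw [hin i hi j hj, hg i hi]
      refine arrivals_congr _ _ fun q hq => ?_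
      rw [M.outbox_congr i (g' i) q fun q' hq' => ih q' (by omega) (by omega) i hi]
    · have hN : (r : WithTop ℕ) < N := by exact_mod_cast hr
      rw [arrivals_of_lt _ (hN.trans_le (hout i hi j hj).1),
        arrivals_of_lt _ (hN.trans_le (hout i hi j hj).2)]

theorem run_decision_congr (K : ℕ) {g g' : Fin n → VI} {G G' : Fin n → Fin n → WithTop ℕ}
    (P : Set (Fin n)) (N : ℕ) (hg : ∀ i ∈ P, g i = g' i)
    (hin : ∀ i ∈ P, ∀ j ∈ P, G i j = G' i j)
    (hout : ∀ i ∉ P, ∀ j ∈ P, (N : WithTop ℕ) ≤ G i j ∧ (N : WithTop ℕ) ≤ G' i j)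
    {r : ℕ} (hr : r < N) {j : Fin n} (hj : j ∈ P) :
    M.decision j (g j) (M.run K g G j) r = M.decision j (g' j) (M.run K g' G' j) r := by
  rw [hg j hj]
  exact M.decision_congr j _ r fun q hq =>
    M.run_congr K P N hg hin hout q (by omega) j hj

end Machine

/-! ### Runs as executions with some processes deemed faulty -/

namespace Algorithm

variable {n : ℕ} {VI : Type a} {VO : Type b} (A : Algorithm.{u, v, w} n VI VO)

/-- A signature of a process in `C` in a message of a process outside `C` stems from an earlier
message from a member of `C` to a process outside `C`. -/
theorem run_unforgeable (K : ℕ) (g : Fin n → VI) (G : Fin n → Fin n → WithTop ℕ)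
    (C : Finset (Fin n)) (r : ℕ) : ∀ i ∉ C, ∀ j, ∀ m ∈ A.runSent K g G i j r, ∀ k ∈ C, ∀ y,
      (k, y) ∈ A.signed m → ∃ s < r, ∃ i' ∈ C, ∃ j' ∉ C,
        ∃ m' ∈ A.runSent K g G i' j' s, (k, y) ∈ A.signed m' := by
  induction r using Nat.strong_induction_on with
  | _ r ih =>
    intro i hi j m hm k hk y hy
    rcases A.own_or_received i (g i) (A.run K g G i) r j m hm k y hy with
      rfl | ⟨s, hs, j', m', hm', hy'⟩
    · exact absurd hk hi
    rw [Machine.run_inbox] at hm'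
    obtain ⟨-, q, hq, hm''⟩ := exists_of_mem_arrivals hm'
    -- Either the received message itself left `C`, or its sender is outside `C` and the signature
    -- is traced further back.
    by_cases hj' : j' ∈ C
    · exact ⟨q, by omega, j', hj', i, hi, m', hm'', hy'⟩
    · obtain ⟨s', hs', h⟩ := ih q (by omega) j' hj' i m' hm'' k hk y hy'
      exact ⟨s', by omega, h⟩

/-- The run as an execution in which only the members of `C` are deemed correct, and the other
processes omit the messages to links that never open. -/
noncomputable def execution {t : ℕ} {δ ρ : ℝ} (hρ : 0 < ρ) (K : ℕ) (hK : 0 < K)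
    (hKδ : ρ / K ≤ δ) (g : Fin n → VI) (G : Fin n → Fin n → WithTop ℕ) (N : ℕ)
    (C : Finset (Fin n)) (hC : n ≤ C.card + t)
    (hG : ∀ i ∈ C, ∀ j ∈ C, G i j ≤ N ∨ ∀ r, A.runSent K g G i j r = 0) :
    Execution A t δ ρ where
  -- An instant lasts `ρ / K ≤ δ`: `K` instants make one clock period, and one instant of transit
  -- respects the delay bound.
  GST := N * (ρ / K)
  GST_nonneg := by positivity
  time r := r * (ρ / K)
  time_nonneg := by simp
  time_strictMono := by
    have : 0 < ρ / K := by positivity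
    intro r s h
    have : (r : ℝ) < s := by exact_mod_cast h
    simp only
    gcongr
  time_tendsto := tendsto_natCast_atTop_atTop.atTop_mul_const (by positivity)
  correct := C
  card_correct := hC
  proposal := g
  input := A.run K g G
  sent i j r := if i ∉ C ∧ G i j = ⊤ then 0 else A.runSent K g G i j r
  sent_eq i hi j r := by simp [hi, Machine.runSent]
  start _ := 0
  start_le _ _ := by simp only [Nat.cast_zero, zero_mul]; positivity
  start_tick i _ := by simp [Machine.run_tick]
  before_start _ _ r hr := by omega
  tick_not_fast i _ r r' hr _ h h' := by
    rw [Machine.run_tick] at h h'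
    have h1 : r + K ≤ r' := by
      have := Nat.le_of_dvd (by omega) ((Nat.dvd_sub h' h))
      omega
    have h2 : (r : ℝ) + K ≤ r' := by exact_mod_cast h1
    calc (r : ℝ) * (ρ / K) + ρ = (r + K) * (ρ / K) := by field_simp
      _ ≤ r' * (ρ / K) := by gcongr
  tick_not_slow i _ r h := by
    rw [Machine.run_tick] at h
    refine ⟨r + K, by omega, ?_, ?_⟩
    · rw [Machine.run_tick]
      exact (Nat.dvd_add_self_right).2 h
    · calc ((r + K : ℕ) : ℝ) * (ρ / K) = r * (ρ / K) + ρ := by push_cast; field_simp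
        _ ≤ _ := by gcongr; exact le_max_left _ _
  received_le_sent i j _ r := by
    simp only [Machine.run_inbox, sum_arrivals]
    split_ifs with h1 h2
    · simp [h2.2] at h1
    · exact le_rfl
    · exact Multiset.zero_le _
    · exact Multiset.zero_le _
  delivered i hi j hj s := by
    rcases hG i hi j hj with h | h
    · refine ⟨max (s + 1) N, ?_, ?_⟩
      · have h0 : 0 < ρ / K := by positivity
        have hδ : 0 ≤ δ := h0.le.trans hKδ
        rcases le_total (s + 1) N with h1 | h1
        · rw [max_eq_right h1]
          linarith [le_max_right ((s : ℝ) * (ρ / K)) (N * (ρ / K))]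
        · rw [max_eq_left h1]
          push_cast
          linarith [le_max_left ((s : ℝ) * (ρ / K)) (N * (ρ / K))]
      · simp only [Machine.run_inbox, sum_arrivals, hi, not_true, false_and, if_false]
        rw [if_pos (h.trans (by exact_mod_cast le_max_right _ _))]
        exact Finset.sum_le_sum_of_subset (Finset.range_mono (le_max_left _ _))
    · refine ⟨0, ?_, ?_⟩
      · have h0 : 0 < ρ / K := by positivity
        have hδ : 0 ≤ δ := h0.le.trans hKδ
        have : 0 ≤ (s : ℝ) * (ρ / K) := by positivity
        simp only [Nat.cast_zero, zero_mul]
        linarith [le_max_left ((s : ℝ) * (ρ / K)) (N * (ρ / K))]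
      · simp only [h, ite_self, Finset.sum_const_zero]
        exact Multiset.zero_le _
  unforgeable i hi j r m hm k hk y hy := by
    have hm' : m ∈ A.runSent K g G i j r := by
      split_ifs at hm with h
      · simp at hm
      · exact hm
    obtain ⟨s, hs, i', hi', j', hj', m', hm'', hy'⟩ :=
      A.run_unforgeable K g G C r i hi j m hm' k hk y hy
    exact ⟨s, hs, i', hi', j', hj', m', by simpa [hi'] using hm'', hy'⟩

variable {A} {t : ℕ} {δ ρ : ℝ} {val : ValidityProperty n t VI VO}

/-- If a process decides `v` while it is isolated from all others, then `v` is admissible for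
every input configuration. -/
theorem Solves.mem_admissible_of_isolated (hA : A.Solves δ ρ val) (ht : 0 < t) (htn : t < n)
    (hρ : 0 < ρ) {K : ℕ} (hK : 0 < K) (hKδ : ρ / K ≤ δ)
    {g₀ : Fin n → VI} {G₀ : Fin n → Fin n → WithTop ℕ} {Q : Fin n} (hself : G₀ Q Q = 0)
    (hisol : ∀ i, i ≠ Q → G₀ i Q = ⊤) {v : VO} {rQ : ℕ}
    (hv : A.decision Q (g₀ Q) (A.run K g₀ G₀ Q) rQ = some v) (c : InputConfig n t VI) :
    v ∈ val.admissible c := by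
  classical
  -- Processes left out by `c` still run the algorithm, so they need some proposal.
  set g : Fin n → VI := fun i => (c.prop i).getD (g₀ i) with hg
  obtain ⟨i₀, hi₀⟩ : ∃ i₀ : Fin n, i₀ ≠ Q :=
    haveI : Nontrivial (Fin n) := Fin.nontrivial_iff_two_le.2 (by omega)
    exists_ne Q
  -- `Q` is silent
  let G₂ : Fin n → Fin n → WithTop ℕ := fun i j => if i = Q ∧ j ≠ Q then ⊤ else 0
  let E₂ : Execution A t δ ρ := A.execution hρ K hK hKδ g G₂ 0 (Finset.univ.erase Q)
    (by rw [Finset.card_erase_of_mem (Finset.mem_univ _)]; simp; omega)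
    (fun i hi j _ => Or.inl (by simp [G₂, Finset.ne_of_mem_erase hi]))
  obtain ⟨d, r₀, hd⟩ := hA.termination E₂ i₀ (by simp [E₂, execution, hi₀])
  change A.decision i₀ (g i₀) (A.run K g G₂ i₀) r₀ = some d at hd
  -- `Q` and the other processes cannot communicate before instant `N`
  set N := max rQ r₀ + 1 with hN
  let G₃ : Fin n → Fin n → WithTop ℕ := fun i j => if (i = Q) = (j = Q) then 0 else N
  have hG₃ : ∀ i j, G₃ i j ≤ N := by
    intro i j
    dsimp only [G₃]
    split_ifs <;> simp
  let E₃ (g' : Fin n → VI) (C : Finset (Fin n)) (hC : n ≤ C.card + t) : Execution A t δ ρ :=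
    A.execution hρ K hK hKδ g' G₃ N C hC (fun i _ j _ => Or.inl (hG₃ i j))
  have hi₀d : ∀ g' : Fin n → VI, (∀ i, i ≠ Q → g' i = g i) →
      A.decision i₀ (g' i₀) (A.run K g' G₃ i₀) r₀ = some d := by
    intro g' hg'
    rw [← hd]
    refine A.run_decision_congr K {Q}ᶜ N (fun i hi => hg' i hi) ?_ ?_ (by omega) hi₀
    · intro i hi j hj
      have hi' : i ≠ Q := hi
      have hj' : j ≠ Q := hj
      simp [G₃, G₂, hi', hj']
    · intro i hi j hj
      have hi' : i = Q := by simpa using hi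
      have hj' : j ≠ Q := hj
      simp [G₃, G₂, hi', hj']
  have huniv : n ≤ (Finset.univ : Finset (Fin n)).card + t := by simp
  -- `Q` proposes as in `g₀` and the others as in `g`: until `N`, `Q` sees its isolated run and the
  -- others see `E₂`.
  have hdv : d = v := by
    let g' := Function.update g Q (g₀ Q)
    refine hA.agreement (E₃ g' Finset.univ huniv) i₀ (Finset.mem_univ _) Q (Finset.mem_univ _)
      d v ⟨r₀, hi₀d g' fun i hi => Function.update_of_ne hi _ _⟩ ⟨rQ, ?_⟩
    change A.decision Q (g' Q) (A.run K g' G₃ Q) rQ = some v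
    rw [← hv]
    refine A.run_decision_congr K {Q} N ?_ ?_ ?_ (by omega) rfl
    · rintro i rfl
      simp [g']
    · rintro i rfl j rfl
      simp [G₃, hself]
    · rintro i hi j rfl
      have hi' : i ≠ j := hi
      simp [G₃, hi', hisol i hi']
  let C : Finset (Fin n) := Finset.univ.filter fun i => (c.prop i).isSome
  have hCn : n ≤ C.card + t := c.card_le
  obtain ⟨i, hi⟩ : C.Nonempty := by
    rw [← Finset.card_pos]
    omega
  have hconf : (E₃ g C hCn).inputConf = c := by
    obtain ⟨f, hf⟩ := c
    simp only [Execution.inputConf, InputConfig.mk.injEq]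
    funext j
    change (if j ∈ C then some (g j) else none) = f j
    cases h : f j <;> simp [C, g, h]
  rw [← hconf]
  -- Agreement with `i₀` is applied with everyone correct, since `i₀` may lie outside `C`; the
  -- decision carries over to `C` because the run is the same.
  obtain ⟨d', hd'⟩ := hA.termination (E₃ g Finset.univ huniv) i (Finset.mem_univ _)
  have hd'v : d' = v := by
    rw [← hdv]
    exact hA.agreement (E₃ g Finset.univ huniv) i (Finset.mem_univ _) i₀ (Finset.mem_univ _)
      d' d hd' ⟨r₀, hi₀d g fun _ _ => rfl⟩
  exact hA.validity (E₃ g C hCn) i hi v (hd'v ▸ hd')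

/-- If every process of a set `B` receives messages from more than `b` processes outside `B`, then
the processes outside `B` send at least `|B| * (b + 1)` messages. -/
theorem _root_.Consensus.Execution.card_mul_le_messageComplexity (E : Execution A t δ ρ)
    (hGST : E.GST = 0) (B : Finset (Fin n)) (b : ℕ) (hB : Disjoint E.correct B)
    (S : Fin n → Finset (Fin n)) (hS : ∀ j ∈ B, b < (S j).card)
    (hSC : ∀ j ∈ B, S j ⊆ E.correct) (hsent : ∀ j ∈ B, ∀ i ∈ S j, ∃ r, E.sent i j r ≠ 0) :
    ((B.card * (b + 1) : ℕ) : ℕ∞) ≤ E.messageComplexity := by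
  classical
  have hex : ∀ i j, ∃ R, j ∈ B → i ∈ S j → E.sent i j R ≠ 0 := by
    intro i j
    by_cases h : j ∈ B ∧ i ∈ S j
    · obtain ⟨r, hr⟩ := hsent j h.1 i h.2
      exact ⟨r, fun _ _ => hr⟩
    · exact ⟨0, fun h1 h2 => absurd ⟨h1, h2⟩ h⟩
  choose f hf using hex
  obtain ⟨R, hR⟩ : ∃ R, ∀ i j, f i j < R :=
    ⟨(∑ i, ∑ j, f i j) + 1, fun i j => Nat.lt_succ_of_le <|
      (Finset.single_le_sum (f := fun j => f i j) (fun _ _ => Nat.zero_le _)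
        (Finset.mem_univ j)).trans
      (Finset.single_le_sum (f := fun i => ∑ j, f i j) (fun _ _ => Nat.zero_le _)
        (Finset.mem_univ i))⟩
  refine le_trans ?_ (le_iSup _ R)
  have hfil : (Finset.range R).filter (fun r => E.GST ≤ E.time r) = Finset.range R := by
    refine Finset.filter_true_of_mem fun r _ => ?_
    rw [hGST]
    exact E.time_nonneg.trans (E.time_strictMono.monotone (Nat.zero_le r))
  rw [Nat.cast_le, hfil, Finset.sum_comm]
  calc B.card * (b + 1) = ∑ j ∈ B, (b + 1) := by simp
    _ ≤ ∑ j ∈ B, ∑ i ∈ S j, 1 := Finset.sum_le_sum fun j hj => by simpa using hS j hj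
    _ ≤ ∑ j ∈ B, ∑ i ∈ S j, ∑ r ∈ Finset.range R, (E.sent i j r).card := by
      refine Finset.sum_le_sum fun j hj => Finset.sum_le_sum fun i hi => ?_
      exact (Nat.one_le_iff_ne_zero.2 (by simpa using hf i j hj hi)).trans
        (Finset.single_le_sum (f := fun r => (E.sent i j r).card) (fun _ _ => Nat.zero_le _)
          (Finset.mem_range.2 (hR i j)))
    _ ≤ ∑ j ∈ B, ∑ i ∈ E.correct, ∑ r ∈ Finset.range R, (E.sent i j r).card :=
      Finset.sum_le_sum fun j hj => Finset.sum_le_sum_of_subset (hSC j hj)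
    _ = ∑ i ∈ E.correct, ∑ r ∈ Finset.range R, ∑ j ∈ B, (E.sent i j r).card := by
      rw [Finset.sum_comm]
      exact Finset.sum_congr rfl fun i _ => Finset.sum_comm
    _ ≤ ∑ i ∈ E.correct, ∑ r ∈ Finset.range R,
          ∑ j ∈ Finset.univ.erase i, (E.sent i j r).card := by
      refine Finset.sum_le_sum fun i hi => Finset.sum_le_sum fun r _ =>
        Finset.sum_le_sum_of_subset fun j hj => ?_
      -- Receivers in `B` are not correct, so no self-addressed message was counted.
      refine Finset.mem_erase.2 ⟨?_, Finset.mem_univ _⟩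
      rintro rfl
      exact Finset.disjoint_left.1 hB hi hj

end Algorithm

end Consensus

/-! ### The quadratic lower bound -/

theorem theorem4 {n t : ℕ} (ht : 0 < t) (htn : t < n)
    {VI : Type*} {VO : Type*} [Nonempty VI]
    (δ ρ : ℝ) (hδ : 0 < δ) (hρ : 0 < ρ)
    (val : Consensus.ValidityProperty n t VI VO) (hval : ¬ val.IsTrivial)
    (A : Consensus.Algorithm n VI VO) (hA : A.Solves δ ρ val) :
    ((⌈(t : ℝ) / 2⌉₊ ^ 2 : ℕ) : ℕ∞) < A.messageComplexity t δ ρ ∧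
      ∃ E : Consensus.Execution A t δ ρ,
        E.GST = 0 ∧ ((⌈(t : ℝ) / 2⌉₊ ^ 2 : ℕ) : ℕ∞) < E.messageComplexity := by
  classical
  suffices h : ∃ E : Consensus.Execution A t δ ρ,
      E.GST = 0 ∧ ((⌈(t : ℝ) / 2⌉₊ ^ 2 : ℕ) : ℕ∞) < E.messageComplexity by
    refine ⟨?_, h⟩
    obtain ⟨E, -, hE⟩ := h
    exact hE.trans_le (le_iSup (fun E : Consensus.Execution A t δ ρ => E.messageComplexity) E)
  set b := ⌈(t : ℝ) / 2⌉₊ with hb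
  have hb0 : 0 < b := Nat.ceil_pos.2 (by positivity)
  have hbt : 2 * b ≤ t + 1 := by
    have h1 : (b : ℝ) < t / 2 + 1 := Nat.ceil_lt_add_one (by positivity)
    have h2 : (2 * b : ℝ) < (t + 2 : ℕ) := by push_cast; linarith
    have h3 : 2 * b < t + 2 := by exact_mod_cast h2
    omega
  obtain ⟨K, hK⟩ := exists_nat_gt (ρ / δ)
  have hK0' : (0 : ℝ) < K := (div_pos hρ hδ).trans hK
  have hK0 : 0 < K := by exact_mod_cast hK0'
  have hKδ : ρ / K ≤ δ := by
    rw [div_lt_iff₀ hδ] at hK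
    rw [div_le_iff₀ hK0']
    linarith
  obtain ⟨p⟩ := ‹Nonempty VI›
  obtain ⟨B, -, hB⟩ := Finset.exists_subset_card_eq
    (show b ≤ (Finset.univ : Finset (Fin n)).card by simp; omega)
  let g : Fin n → VI := fun _ => p
  -- Links within `B` are closed too, so each member of `B` is fully isolated.
  let G : Fin n → Fin n → WithTop ℕ := fun i j => if i ≠ j ∧ j ∈ B then ⊤ else 0
  have hcard : Bᶜ.card = n - b := by rw [Finset.card_compl, hB, Fintype.card_fin]
  let E : Consensus.Execution A t δ ρ := A.execution hρ K hK0 hKδ g G 0 Bᶜ (by omega)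
    (fun i _ j hj => Or.inl (by simp [G, Finset.mem_compl.1 hj]))
  have hGST : E.GST = 0 := by simp [E, Consensus.Algorithm.execution]
  refine ⟨E, hGST, ?_⟩
  let S : Fin n → Finset (Fin n) := fun j =>
    Bᶜ.filter fun i => ∃ r, A.runSent K g G i j r ≠ 0
  by_cases hS : ∀ j ∈ B, b < (S j).card
  · refine lt_of_lt_of_le ?_ (E.card_mul_le_messageComplexity hGST B b disjoint_compl_left S hS
      (fun j _ => Finset.filter_subset _ _) fun j _ i hi => ?_)
    · rw [hB, Nat.cast_lt]
      nlinarith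
    · obtain ⟨hi, r, hr⟩ := Finset.mem_filter.1 hi
      refine ⟨r, ?_⟩
      change (if i ∉ Bᶜ ∧ G i j = ⊤ then 0 else A.runSent K g G i j r) ≠ 0
      rwa [if_neg fun h => h.1 hi]
  · push Not at hS
    obtain ⟨Q, hQ, hSQ⟩ := hS
    -- the processes that send to `Q` fail to do so, and `Q` is correct
    have hfaulty : (B.erase Q ∪ S Q).card ≤ t := by
      refine (Finset.card_union_le _ _).trans ?_
      rw [Finset.card_erase_of_mem hQ]
      omega
    let E' : Consensus.Execution A t δ ρ := A.execution hρ K hK0 hKδ g G 0 (B.erase Q ∪ S Q)ᶜ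
      (by rw [Finset.card_compl, Fintype.card_fin]; omega) (by
        intro i hi j hj
        simp only [Finset.mem_compl, Finset.mem_union, not_or, Finset.mem_erase,
          not_and] at hi hj
        -- The only correct process behind closed links is `Q`, and a correct `i ≠ Q` is outside `S
        -- Q`, so it never writes to `Q`.
        by_cases hij : i ≠ j ∧ j ∈ B
        · right
          obtain rfl : j = Q := by
            by_contra h
            exact hj.1 h hij.2
          intro r
          by_contra hr
          exact hi.2 (Finset.mem_filter.2 ⟨Finset.mem_compl.2 (hi.1 hij.1), r, hr⟩)
        · left
          simp [G, hij])
    have hQC : Q ∈ E'.correct := by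
      change Q ∈ (B.erase Q ∪ S Q)ᶜ
      simp [S, hQ]
    obtain ⟨v, rQ, hv⟩ := hA.termination E' Q hQC
    refine absurd ⟨v, fun c => ?_⟩ hval
    exact hA.mem_admissible_of_isolated ht htn hρ hK0 hKδ (g₀ := g) (G₀ := G) (by simp [G])
      (fun i hi => by simp [G, hi, hQ]) hv c
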